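/- Let $A$ be a (discrete) group, let $H, K \le A$ be subgroups and let $\varphi\colon H\to K$ be an isomorphism. Suppose that there exists an automorphism $\alpha\colon A\to A$ such that $\alpha|_H=\varphi$. If $A$ is amenable, then the HNN extension $$A\ast_\varphi=\langle A,t \mid t h t^{-1}=\varphi(h)\ \ \forall h\in H\rangle$$ is residually amenable. Here a group $G$ is amenable if the space $\ell^\infty(G,\mathbb{R})$ of bounded real functions on $G$ admits a left-invariant mean, that is, a positive linear functional $m$ with $m(1)=1$ and $m(x\mapsto f(gx))=m(f)$ for all $g\in G$ and all $f\in\ell^\infty(G,\mathbb{R})$; and $G$ is residually amenable if for every non-trivial $g\in G$ there are an amenable group $C$ and a surjective homomorphism $\pi\colon G\twoheadrightarrow C$ with $\pi(g)\neq e_C$. -/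

import Mathlib

open scoped ENNReal

universe u

/-- A (discrete) group `G` is amenable if the space `ℓ^∞(G, ℝ)` of all bounded real functions on
`G` carries a left-invariant mean: a linear functional `m` that is positive, normalized by
`m 1 = 1`, and takes the same value on `f` and on each left translate `x ↦ f (g * x)` of `f`. -/
def IsAmenableGroup (G : Type u) [Group G] : Prop :=
  ∃ m : lp (fun _ : G => ℝ) ∞ →ₗ[ℝ] ℝ,
    (∀ f : lp (fun _ : G => ℝ) ∞, (∀ x, 0 ≤ f x) → 0 ≤ m f) ∧
    m 1 = 1 ∧
    ∀ (g : G) (f f' : lp (fun _ : G => ℝ) ∞), (∀ x, f' x = f (g * x)) → m f' = m f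

/-- A group `G` is residually amenable if every nontrivial element of `G` has nontrivial image
under some surjective homomorphism from `G` onto an amenable group. -/
def IsResiduallyAmenable (G : Type u) [Group G] : Prop :=
  ∀ g : G, g ≠ 1 → ∃ (C : Type u) (_ : Group C) (π : G →* C),
    IsAmenableGroup C ∧ Function.Surjective π ∧ π g ≠ 1

/-! It suffices to build, for every `n`, a homomorphism `π` to an amenable group `Q` that is
injective on `A` and sends no nonempty reduced word of length at most `n` into `π(A)`. For `n = 0`
the automorphism `α` gives `Q = A ⋊ ℤ`.

To pass from `n` to `n + 1`, replace `Q` by `ℤ^(Q/π(H)) ⋊ Q`, still amenable as an extension by an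
abelian group. A word traces a path in the graph with vertices `Q/π(A)` and edges `Q/π(H)`, and the
new coordinate counts its signed edge crossings. If the word maps into the image of `A`, every count
is zero, so the first edge is later crossed backwards. The piece in between is shorter and maps into
`π(A)`, hence is empty by induction; the word then backtracks at once and is not reduced
(`SeparatesReduced.crossingHom`). -/

open HNNExtension Filter

/-! ### Means on bounded functions -/

section Means

/-- A real function is bounded. -/
def BoundedFun {X : Type*} (f : X → ℝ) : Prop := ∃ C : ℝ, ∀ x, |f x| ≤ C

theorem BoundedFun.add {X : Type*} {f g : X → ℝ} (hf : BoundedFun f) (hg : BoundedFun g) :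
    BoundedFun (fun x => f x + g x) := by
  obtain ⟨C, hC⟩ := hf
  obtain ⟨D, hD⟩ := hg
  exact ⟨C + D, fun x => (abs_add_le _ _).trans (add_le_add (hC x) (hD x))⟩

theorem BoundedFun.const_mul {X : Type*} {f : X → ℝ} (c : ℝ) (hf : BoundedFun f) :
    BoundedFun (fun x => c * f x) := by
  obtain ⟨C, hC⟩ := hf
  exact ⟨|c| * C, fun x => by
    rw [abs_mul]; exact mul_le_mul_of_nonneg_left (hC x) (abs_nonneg c)⟩

theorem BoundedFun.comp {X Y : Type*} {f : X → ℝ} (hf : BoundedFun f) (k : Y → X) :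
    BoundedFun (fun y => f (k y)) := by
  obtain ⟨C, hC⟩ := hf
  exact ⟨C, fun y => hC (k y)⟩

theorem boundedFun_const {X : Type*} (c : ℝ) : BoundedFun (fun _ : X => c) :=
  ⟨|c|, fun _ => le_rfl⟩

/-- A functional on all real functions whose restriction to the bounded ones is a mean. -/
structure IsMean {X : Type*} (M : (X → ℝ) → ℝ) : Prop where
  map_add : ∀ f g, BoundedFun f → BoundedFun g → M (fun x => f x + g x) = M f + M g
  map_const_mul : ∀ (c : ℝ) f, BoundedFun f → M (fun x => c * f x) = c * M f
  nonneg : ∀ f, BoundedFun f → (∀ x, 0 ≤ f x) → 0 ≤ M f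
  map_one : M (fun _ => 1) = 1

namespace IsMean

variable {X : Type*} {M : (X → ℝ) → ℝ}

theorem map_const (hM : IsMean M) (c : ℝ) : M (fun _ => c) = c := by
  simpa [hM.map_one] using hM.map_const_mul c (fun _ => 1) (boundedFun_const 1)

theorem mono (hM : IsMean M) {f g : X → ℝ} (hf : BoundedFun f) (hg : BoundedFun g)
    (h : ∀ x, f x ≤ g x) : M f ≤ M g := by
  have hs : BoundedFun (fun x => (-1) * f x) := hf.const_mul (-1)
  have h0 := hM.nonneg _ (hg.add hs) (fun x => by linarith [h x])
  rw [hM.map_add _ _ hg hs, hM.map_const_mul _ _ hf] at h0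
  linarith

theorem abs_le (hM : IsMean M) {f : X → ℝ} {C : ℝ} (h : ∀ x, |f x| ≤ C) : |M f| ≤ C := by
  have hf : BoundedFun f := ⟨C, h⟩
  refine _root_.abs_le.2 ⟨?_, ?_⟩
  · rw [← hM.map_const (-C)]
    exact hM.mono (boundedFun_const _) hf (fun x => (_root_.abs_le.1 (h x)).1)
  · rw [← hM.map_const C]
    exact hM.mono hf (boundedFun_const _) (fun x => (_root_.abs_le.1 (h x)).2)

/-- The mean obtained by averaging means `N y` over a mean `M`. -/
theorem bind {Y : Type*} {Z : Type*} {N : Y → (Z → ℝ) → ℝ} {M : (Y → ℝ) → ℝ}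
    (hM : IsMean M) (hN : ∀ y, IsMean (N y)) : IsMean (fun f => M (fun y => N y f)) := by
  have hb : ∀ f : Z → ℝ, BoundedFun f → BoundedFun (fun y => N y f) := by
    rintro f ⟨C, hC⟩
    exact ⟨C, fun y => (hN y).abs_le hC⟩
  refine ⟨fun f g hf hg => ?_, fun c f hf => ?_, fun f hf h => ?_, ?_⟩
  · rw [← hM.map_add _ _ (hb f hf) (hb g hg)]
    congr 1
    funext y
    exact (hN y).map_add f g hf hg
  · rw [← hM.map_const_mul _ _ (hb f hf)]
    congr 1
    funext y
    exact (hN y).map_const_mul c f hf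
  · exact hM.nonneg _ (hb f hf) (fun y => (hN y).nonneg f hf h)
  · simp only [(hN _).map_one, hM.map_one]

/-- Evaluation at a point is a mean. -/
theorem eval (x : X) : IsMean (fun f : X → ℝ => f x) :=
  ⟨fun _ _ _ _ => rfl, fun _ _ _ => rfl, fun _ _ h => h x, rfl⟩

/-- The push-forward of a mean. -/
theorem map (hM : IsMean M) {Y : Type*} (k : X → Y) :
    IsMean (fun f : Y → ℝ => M (fun x => f (k x))) :=
  hM.bind (fun x => eval (k x))

end IsMean

theorem tendsto_lim_of_boundedFun {ι : Type*} (U : Ultrafilter ι) {a : ι → ℝ}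
    (ha : BoundedFun a) : Tendsto a U (nhds (limUnder (U : Filter ι) a)) := by
  obtain ⟨C, hC⟩ := ha
  obtain ⟨y, -, hy⟩ := (isCompact_Icc (a := -C) (b := C)).ultrafilter_le_nhds (U.map a) (by
    rw [le_principal_iff]
    exact Eventually.of_forall (f := (U : Filter ι)) fun i => abs_le.1 (hC i))
  exact tendsto_nhds_limUnder ⟨y, hy⟩

/-- The limit along an ultrafilter is a mean. -/
theorem isMean_limUnder {ι : Type*} (U : Ultrafilter ι) :
    IsMean (fun a : ι → ℝ => limUnder (U : Filter ι) a) := by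
  refine ⟨fun f g hf hg => ?_, fun c f hf => ?_, fun f hf h => ?_, ?_⟩
  · exact ((tendsto_lim_of_boundedFun U hf).add (tendsto_lim_of_boundedFun U hg)).limUnder_eq
  · exact ((tendsto_lim_of_boundedFun U hf).const_mul c).limUnder_eq
  · exact ge_of_tendsto (tendsto_lim_of_boundedFun U hf) (Eventually.of_forall h)
  · exact tendsto_const_nhds.limUnder_eq

end Means

/-! ### Invariant means: subgroups, semidirect products, abelian groups -/

section Amenability

/-- The functional `M` is invariant under left translation by `g`. -/
def InvariantUnder {G : Type*} [Group G] (M : (G → ℝ) → ℝ) (g : G) : Prop :=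
  ∀ f, BoundedFun f → M (fun x => f (g * x)) = M f

/-- The group carries a left-invariant mean. -/
def HasInvariantMean (G : Type*) [Group G] : Prop :=
  ∃ M : (G → ℝ) → ℝ, IsMean M ∧ ∀ g, InvariantUnder M g

theorem BoundedFun.memℓp {G : Type*} {f : G → ℝ} (hf : BoundedFun f) :
    Memℓp (E := fun _ : G => ℝ) f ∞ := by
  obtain ⟨C, hC⟩ := hf
  refine memℓp_infty ⟨C, ?_⟩
  rintro _ ⟨x, rfl⟩
  exact hC x

theorem boundedFun_coe_lp {G : Type*} (f : lp (fun _ : G => ℝ) ∞) : BoundedFun f :=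
  ⟨‖f‖, fun x => lp.norm_apply_le_norm (by simp) f x⟩

theorem isAmenableGroup_iff_hasInvariantMean (G : Type u) [Group G] :
    IsAmenableGroup G ↔ HasInvariantMean G := by
  classical
  constructor
  · rintro ⟨m, hpos, hone, hinv⟩
    -- The value 0 off the bounded functions is arbitrary and never matters.
    let M : (G → ℝ) → ℝ := fun f => if h : BoundedFun f then m ⟨f, h.memℓp⟩ else 0
    have hM : ∀ f (h : BoundedFun f), M f = m ⟨f, h.memℓp⟩ := fun f h => dif_pos h
    refine ⟨M, ⟨fun f g hf hg => ?_, fun c f hf => ?_, fun f hf h => ?_, ?_⟩, fun g f hf => ?_⟩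
    · rw [hM f hf, hM g hg, hM _ (hf.add hg), ← map_add]
      rfl
    · rw [hM f hf, hM _ (hf.const_mul c), ← smul_eq_mul, ← map_smul]
      rfl
    · rw [hM f hf]
      exact hpos _ h
    · exact (hM _ (boundedFun_const 1)).trans hone
    · rw [hM f hf, hM _ (hf.comp _)]
      exact hinv g _ _ fun _ => rfl
  · rintro ⟨M, hM, hinv⟩
    refine ⟨⟨⟨fun f => M f, fun f g => ?_⟩, fun c f => ?_⟩, fun f h => ?_, ?_, fun g f f' h => ?_⟩
    · exact hM.map_add _ _ (boundedFun_coe_lp f) (boundedFun_coe_lp g)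
    · exact hM.map_const_mul c _ (boundedFun_coe_lp f)
    · exact hM.nonneg _ (boundedFun_coe_lp f) h
    · exact hM.map_one
    · change M f' = M f
      rw [← hinv g f (boundedFun_coe_lp f)]
      congr 1
      funext x
      exact h x

/-- A subgroup of a group with an invariant mean has an invariant mean. -/
theorem HasInvariantMean.subgroup {G : Type*} [Group G] (hG : HasInvariantMean G)
    (S : Subgroup G) : HasInvariantMean S := by
  obtain ⟨M, hM, hinv⟩ := hG
  -- Since `G = S * T`, the `S`-component is equivariant under left multiplication by `S`, so the
  -- mean pushes forward along it.
  obtain ⟨T, hT, -⟩ := S.exists_isComplement_right 1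
  let k : G → S := fun x => (hT.equiv x).1
  refine ⟨_, hM.map k, fun g f hf => ?_⟩
  change M (fun x => f (g * k x)) = M fun x => f (k x)
  rw [← hinv (g : G) (fun x => f (k x)) (hf.comp k)]
  congr 1
  funext x
  congr 1
  exact (congrArg Prod.fst (hT.equiv_mul_left g x)).symm

/-- Amenability of a semidirect product. -/
theorem HasInvariantMean.semidirectProduct {N Q : Type*} [Group N] [Group Q]
    (hN : HasInvariantMean N) (hQ : HasInvariantMean Q) (ψ : Q →* MulAut N) :
    HasInvariantMean (N ⋊[ψ] Q) := by
  obtain ⟨M, hM, hMinv⟩ := hN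
  obtain ⟨L, hL, hLinv⟩ := hQ
  refine ⟨_, hL.bind fun q => hM.map fun n =>
    (SemidirectProduct.inr q * SemidirectProduct.inl n : N ⋊[ψ] Q), fun g f hf => ?_⟩
  have key : ∀ q : Q,
      M (fun n => f (g * (SemidirectProduct.inr q * SemidirectProduct.inl n))) =
      M (fun n => f (SemidirectProduct.inr (g.right * q) * SemidirectProduct.inl n)) := by
    intro q
    -- Moving `g.left` to the right past `inr (g.right * q)` twists it by `ψ (g.right * q)⁻¹`;
    -- invariance of `M` absorbs the result.
    rw [← hMinv (ψ (g.right * q)⁻¹ g.left)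
      (fun n => f (SemidirectProduct.inr (g.right * q) * SemidirectProduct.inl n)) (hf.comp _)]
    congr 1
    funext n
    congr 1
    ext <;> simp
  simp only [key]
  refine hLinv g.right
    (fun q => M fun n => f (SemidirectProduct.inr q * SemidirectProduct.inl n)) ?_
  obtain ⟨C, hC⟩ := hf
  exact ⟨C, fun q => hM.abs_le fun n => hC _⟩

/-- The Cesàro mean of the first `n + 1` terms of a sequence. -/
theorem isMean_cesaro (n : ℕ) :
    IsMean (fun a : ℕ → ℝ => ((n : ℝ) + 1)⁻¹ * ∑ k ∈ Finset.range (n + 1), a k) := by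
  have hn : ((n : ℝ) + 1) ≠ 0 := by positivity
  refine ⟨fun f g _ _ => ?_, fun c f _ => ?_, fun f _ h => ?_, ?_⟩
  · rw [Finset.sum_add_distrib, mul_add]
  · rw [← Finset.mul_sum]; ring
  · exact mul_nonneg (by positivity) (Finset.sum_nonneg fun k _ => h k)
  · simp [hn]

/-- There is a shift-invariant mean on bounded sequences. -/
theorem exists_banach_limit :
    ∃ L : (ℕ → ℝ) → ℝ, IsMean L ∧ ∀ a, BoundedFun a → L (fun k => a (k + 1)) = L a := by
  let U : Ultrafilter ℕ := Ultrafilter.of atTop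
  refine ⟨_, (isMean_limUnder U).bind isMean_cesaro, fun a ha => ?_⟩
  have hb : BoundedFun fun n : ℕ => ((n : ℝ) + 1)⁻¹ * ∑ k ∈ Finset.range (n + 1), a k := by
    obtain ⟨C, hC⟩ := ha
    exact ⟨C, fun n => (isMean_cesaro n).abs_le hC⟩
  refine Tendsto.limUnder_eq ?_
  -- The Cesàro sums of `a` and of its shift differ only in two end terms.
  have hdiff : Tendsto (fun n : ℕ => ((n : ℝ) + 1)⁻¹ * (a (n + 1) - a 0)) U (nhds 0) := by
    refine Tendsto.mono_left ?_ (Ultrafilter.of_le atTop)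
    obtain ⟨C, hC⟩ := ha
    have h0 : Tendsto (fun n : ℕ => ((n : ℝ) + 1)⁻¹) atTop (nhds 0) := by
      simpa using tendsto_one_div_add_atTop_nhds_zero_nat (𝕜 := ℝ)
    refine h0.zero_mul_isBoundedUnder_le ⟨2 * C, ?_⟩
    rw [eventually_map]
    refine Eventually.of_forall fun n => ?_
    have h1 := abs_le.1 (hC (n + 1))
    have h2 := abs_le.1 (hC 0)
    exact abs_le.2 ⟨by linarith, by linarith⟩
  have := (tendsto_lim_of_boundedFun U hb).add hdiff
  rw [add_zero] at this
  refine this.congr fun n => ?_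
  rw [← mul_add]
  congr 1
  have h1 := Finset.sum_range_succ a (n + 1)
  have h2 := Finset.sum_range_succ' a (n + 1)
  linarith

/-- In a commutative group, a mean can be made invariant under one more element. -/
theorem exists_isMean_invariantUnder_insert {G : Type*} [CommGroup G] {M : (G → ℝ) → ℝ}
    (hM : IsMean M) (g : G) : ∃ M' : (G → ℝ) → ℝ, IsMean M' ∧ InvariantUnder M' g ∧
      ∀ h, InvariantUnder M h → InvariantUnder M' h := by
  obtain ⟨L, hL, hshift⟩ := exists_banach_limit
  refine ⟨_, hL.bind fun k => hM.map fun x => g ^ k * x, fun f hf => ?_, fun h hh f hf => ?_⟩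
  · have hb : BoundedFun fun k : ℕ => M fun x => f (g ^ k * x) := by
      obtain ⟨C, hC⟩ := hf
      exact ⟨C, fun k => hM.abs_le fun x => hC _⟩
    beta_reduce
    rw [← hshift _ hb]
    simp only [pow_succ', mul_assoc]
  · beta_reduce
    congr 1
    funext k
    rw [← hh (fun x => f (g ^ k * x)) (hf.comp _)]
    simp only [mul_left_comm]

/-- Commutative groups are amenable. -/
theorem hasInvariantMean_of_commGroup (G : Type*) [CommGroup G] : HasInvariantMean G := by
  classical
  have hfin : ∀ s : Finset G, ∃ M : (G → ℝ) → ℝ, IsMean M ∧ ∀ g ∈ s, InvariantUnder M g := by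
    intro s
    induction s using Finset.induction_on with
    | empty => exact ⟨_, IsMean.eval 1, by simp⟩
    | insert g s _ ih =>
      obtain ⟨M, hM, hs⟩ := ih
      obtain ⟨M', hM', hg, hM's⟩ := exists_isMean_invariantUnder_insert hM g
      refine ⟨M', hM', fun h hh => ?_⟩
      rcases Finset.mem_insert.1 hh with rfl | hh
      · exact hg
      · exact hM's h (hs h hh)
  choose M hM hinv using hfin
  let U : Ultrafilter (Finset G) := Ultrafilter.of atTop
  refine ⟨_, (isMean_limUnder U).bind hM, fun g f hf => ?_⟩
  have hb : BoundedFun fun s => M s f := by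
    obtain ⟨C, hC⟩ := hf
    exact ⟨C, fun s => (hM s).abs_le hC⟩
  refine Tendsto.limUnder_eq ((tendsto_lim_of_boundedFun U hb).congr' ?_)
  refine Eventually.filter_mono (Ultrafilter.of_le atTop) ?_
  -- `M s` is `g`-invariant as soon as `g ∈ s`.
  filter_upwards [eventually_ge_atTop {g}] with s hs
  exact (hinv s g (hs (Finset.mem_singleton_self g)) f hf).symm

end Amenability

/-! ### Signed edge crossings and the inductive step -/

section Wreath

variable {A : Type*} [Group A] {H K : Subgroup A} {φ : H ≃* K}

/-- The product `t ^ u₁ * g₁ * t ^ u₂ * g₂ * ⋯` in the HNN extension. -/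
def wordProd (φ : H ≃* K) (l : List (ℤˣ × A)) : HNNExtension A H K φ :=
  (l.map fun x => t ^ (x.1 : ℤ) * of x.2).prod

@[simp]
theorem wordProd_nil : wordProd φ [] = 1 := rfl

@[simp]
theorem wordProd_cons (x : ℤˣ × A) (l : List (ℤˣ × A)) :
    wordProd φ (x :: l) = t ^ (x.1 : ℤ) * of x.2 * wordProd φ l := by
  simp [wordProd]

/-- The condition on a list that makes it the tail of a reduced word. -/
def IsReducedList (H K : Subgroup A) (l : List (ℤˣ × A)) : Prop :=
  l.IsChain fun a b => a.2 ∈ toSubgroup H K a.1 → a.1 = b.1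

variable {Q : Type*} [Group Q] (π : HNNExtension A H K φ →* Q)

/-- The image in `Q` of the subgroup along which the stable letter conjugates. -/
abbrev edgeGroup : Subgroup Q := H.map (π.comp of)

/-- The coset that labels the edge crossed by `t ^ u` from the base vertex. -/
def baseEdge (u : ℤˣ) : Q ⧸ edgeGroup π :=
  if u = 1 then (π t : Q) else ((1 : Q) : Q ⧸ edgeGroup π)

theorem zpow_smul_baseEdge (u : ℤˣ) :
    (π t ^ (u : ℤ)) • baseEdge π (-u) = baseEdge π u := by
  rcases Int.units_eq_one_or u with rfl | rfl
  · simp [baseEdge]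
  · simp [baseEdge]

/-- The stabilizers of the two base edges are `π(H)` and `π(K)`: this turns recrossing an edge
backwards into the membership that reducedness forbids. -/
theorem smul_baseEdge_neg_eq_iff (u : ℤˣ) (q : Q) :
    q • baseEdge π (-u) = baseEdge π (-u) ↔ ∃ a ∈ toSubgroup H K u, π (of a) = q := by
  rcases Int.units_eq_one_or u with rfl | rfl
  · have h : q • ((1 : Q) : Q ⧸ edgeGroup π) = ((1 : Q) : Q ⧸ edgeGroup π) ↔
        q ∈ edgeGroup π := by
      rw [MulAction.Quotient.smul_coe, eq_comm, QuotientGroup.eq]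
      simp
    simpa [baseEdge] using h
  · have h : q • ((π t : Q) : Q ⧸ edgeGroup π) = ((π t : Q) : Q ⧸ edgeGroup π) ↔
        (π t)⁻¹ * q * π t ∈ edgeGroup π := by
      rw [MulAction.Quotient.smul_coe, eq_comm, QuotientGroup.eq, smul_eq_mul, mul_assoc]
    have h' : (∃ a ∈ K, π (of a) = q) ↔ (π t)⁻¹ * q * π t ∈ edgeGroup π := by
      constructor
      · rintro ⟨a, ha, rfl⟩
        refine ⟨φ.symm ⟨a, ha⟩, (φ.symm ⟨a, ha⟩).2, ?_⟩
        have := congrArg π (equiv_symm_eq_conj (φ := φ) ⟨a, ha⟩)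
        simpa using this
      · rintro ⟨a, ha, h⟩
        refine ⟨φ ⟨a, ha⟩, (φ ⟨a, ha⟩).2, ?_⟩
        rw [equiv_eq_conj]
        simp only [map_mul, map_inv]
        change π (of a) = _ at h
        rw [h]
        group
    simpa [baseEdge, h'] using h

/-- The group of integer-valued functions on the edges extended by `Q`. -/
abbrev EdgeWreath : Type _ :=
  ((Q ⧸ edgeGroup π) → Multiplicative ℤ) ⋊[mulAutArrow] Q

open Classical in
/-- The indicator function of the edge crossed by the stable letter. -/
noncomputable def edgeIndicator : (Q ⧸ edgeGroup π) → Multiplicative ℤ :=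
  fun x => Multiplicative.ofAdd (if x = baseEdge π 1 then 1 else 0)

/-- The homomorphism that records the image in `Q` and the signed edge crossings. -/
noncomputable def crossingHom : HNNExtension A H K φ →* EdgeWreath π :=
  lift (SemidirectProduct.inr.comp (π.comp of)) ⟨edgeIndicator π, π t⟩ (by
    classical
    intro a
    ext x
    · have hb : (π (of (φ a : A)))⁻¹ • baseEdge π 1 = baseEdge π 1 := by
        rw [inv_smul_eq_iff, eq_comm]
        exact (smul_baseEdge_neg_eq_iff π (-1) _).2 ⟨φ a, (φ a).2, rfl⟩
      have : ((π (of (φ a : A)))⁻¹ • x = baseEdge π 1) ↔ x = baseEdge π 1 := by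
        conv_lhs => rw [← hb]
        exact (MulAction.injective _).eq_iff
      change edgeIndicator π x * 1 = 1 * edgeIndicator π ((π (of (φ a : A)))⁻¹ • x)
      rw [mul_one, one_mul]
      exact congrArg Multiplicative.ofAdd (if_congr this.symm rfl rfl)
    · simp [← map_mul, t_mul_of])

theorem crossingHom_of (a : A) :
    crossingHom π (of a) = SemidirectProduct.inr (π (of a)) := by
  simp [crossingHom]

theorem crossingHom_t : crossingHom π t = ⟨edgeIndicator π, π t⟩ := by
  simp [crossingHom]

theorem right_crossingHom (g : HNNExtension A H K φ) : (crossingHom π g).right = π g := by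
  have : (SemidirectProduct.rightHom.comp (crossingHom π)) = π := by
    ext
    · simp [crossingHom_of]
    · simp [crossingHom_t]
  exact DFunLike.congr_fun this g

/-- The signed number of crossings of the edge `x`. -/
noncomputable def crossings (g : HNNExtension A H K φ) (x : Q ⧸ edgeGroup π) : ℤ :=
  Multiplicative.toAdd ((crossingHom π g).left x)

/-- The cocycle rule: the path of `h` is traversed after translation by `π g`. -/
theorem crossings_mul (g h : HNNExtension A H K φ) (x : Q ⧸ edgeGroup π) :
    crossings π (g * h) x = crossings π g x + crossings π h ((π g)⁻¹ • x) := by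
  rw [← right_crossingHom π g]
  simp only [crossings, map_mul, SemidirectProduct.mul_left]
  rfl

theorem crossings_of (a : A) (x : Q ⧸ edgeGroup π) : crossings π (of a) x = 0 := by
  simp [crossings, crossingHom_of]

open Classical in
theorem crossings_t_zpow (u : ℤˣ) (x : Q ⧸ edgeGroup π) :
    crossings π (t ^ (u : ℤ)) x = if x = baseEdge π u then (u : ℤ) else 0 := by
  have ht : ∀ x, crossings π t x = if x = baseEdge π 1 then 1 else 0 := fun x => by
    simp [crossings, crossingHom_t, edgeIndicator]
  rcases Int.units_eq_one_or u with rfl | rfl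
  · simpa using ht x
  · have h := crossings_mul π t t⁻¹ (π t • x)
    have h1 : crossings π (1 : HNNExtension A H K φ) (π t • x) = 0 := by
      simpa using crossings_of π 1 (π t • x)
    rw [mul_inv_cancel, h1, ht, inv_smul_smul] at h
    have hx : π t • x = baseEdge π 1 ↔ x = baseEdge π (-1) := by
      have := zpow_smul_baseEdge π 1
      rw [← this]
      simp
    rw [if_congr hx rfl rfl] at h
    simp only [Units.val_neg, Units.val_one, Int.reduceNeg, zpow_neg, zpow_one]
    split_ifs at h ⊢ <;> omega

theorem crossings_wordProd_cons (u : ℤˣ) (a : A) (l : List (ℤˣ × A)) (x : Q ⧸ edgeGroup π) :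
    crossings π (wordProd φ ((u, a) :: l)) x =
      crossings π (t ^ (u : ℤ)) x +
        crossings π (wordProd φ l) ((π (t ^ (u : ℤ) * of a))⁻¹ • x) := by
  rw [wordProd_cons, crossings_mul, crossings_mul, crossings_of, add_zero]

/-- A path that never crosses `x` in direction `-u` has crossing number of sign `u` there. -/
theorem mul_crossings_wordProd_nonneg (u : ℤˣ) (l : List (ℤˣ × A)) (x : Q ⧸ edgeGroup π)
    (h : ∀ l₁ a l₂, l = l₁ ++ (-u, a) :: l₂ → π (wordProd φ l₁) • baseEdge π (-u) ≠ x) :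
    0 ≤ (u : ℤ) * crossings π (wordProd φ l) x := by
  classical
  induction l generalizing x with
  | nil =>
    have := crossings_of π 1 x
    rw [map_one] at this
    simp [this]
  | cons b l ih =>
    obtain ⟨v, b⟩ := b
    rw [crossings_wordProd_cons, mul_add]
    refine add_nonneg ?_ (ih _ fun l₁ a l₂ hl hx => ?_)
    · rw [crossings_t_zpow]
      split_ifs with hx
      · have huv : v = u := by
          by_contra hne
          have hv : v = -u := (Int.units_ne_iff_eq_neg).1 hne
          subst hv
          exact h [] b l rfl (by simpa using hx.symm)
        subst huv
        exact mul_self_nonneg _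
      · simp
    · refine h ((v, b) :: l₁) a l₂ (by rw [hl]; rfl) ?_
      rw [wordProd_cons, map_mul, mul_smul, hx, smul_inv_smul]

/-- The homomorphism `π` keeps nonempty reduced words of length at most `n` out of the
image of the base group. -/
def SeparatesReduced (n : ℕ) : Prop :=
  ∀ l : List (ℤˣ × A), IsReducedList H K l → l ≠ [] → l.length ≤ n →
    ∀ a : A, π (wordProd φ l) ≠ π (of a)

theorem crossingHom_comp_of_injective (hinj : Function.Injective (π.comp of)) :
    Function.Injective ((crossingHom π).comp of) := by
  intro a b hab
  simp only [MonoidHom.comp_apply, crossingHom_of, SemidirectProduct.inr_inj] at hab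
  exact hinj hab

theorem SeparatesReduced.crossingHom {n : ℕ} (hn : SeparatesReduced π n)
    (hinj : Function.Injective (π.comp of)) : SeparatesReduced (crossingHom π) (n + 1) := by
  classical
  intro l hl hne hlen a₀ heq
  obtain _ | ⟨⟨u, a⟩, l⟩ := l
  · exact hne rfl
  have hzero : crossings π (wordProd φ ((u, a) :: l)) (baseEdge π u) = 0 := by
    rw [crossings, heq]
    exact crossings_of π a₀ _
  rw [crossings_wordProd_cons, crossings_t_zpow, if_pos rfl] at hzero
  have hbase : (π (t ^ (u : ℤ) * of a))⁻¹ • baseEdge π u = (π (of a))⁻¹ • baseEdge π (-u) := by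
    rw [map_mul, mul_inv_rev, mul_smul, map_zpow, inv_smul_eq_iff.2 (zpow_smul_baseEdge π u).symm]
  rw [hbase] at hzero
  -- If the tail never recrosses the first edge in direction `-u`, its count there, times `u`, is
  -- nonnegative; yet `hzero` makes that count `-u`.
  have hpos := mul_crossings_wordProd_nonneg π u l ((π (of a))⁻¹ • baseEdge π (-u)) (by
    intro l₁ b l₂ hsplit hx
    rw [eq_inv_smul_iff, ← mul_smul, smul_baseEdge_neg_eq_iff] at hx
    obtain ⟨c, hc, hcl⟩ := hx
    subst hsplit
    obtain _ | ⟨y, l₁⟩ := l₁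
    -- Immediate backtracking: reducedness would force `u = -u`.
    · have hca : c = a := hinj (by simpa using hcl)
      subst hca
      have := (List.isChain_cons_cons.1 hl).1 hc
      simp at this
    · refine hn (y :: l₁) ?_ (by simp) ?_ (a⁻¹ * c) ?_
      · exact (List.isChain_append.1 (List.isChain_cons.1 hl).2).1
      · simp only [List.length_cons, List.length_append] at hlen ⊢
        omega
      · rw [map_mul, map_mul, hcl, map_inv, map_inv, inv_mul_cancel_left])
  rw [eq_neg_of_add_eq_zero_right hzero] at hpos
  have : (u : ℤ) * u = 1 := by
    rw [← Units.val_mul, Int.units_mul_self, Units.val_one]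
  rw [mul_neg, this] at hpos
  omega

end Wreath

/-! ### Iterating the construction and concluding -/

section Residual

variable {A : Type u} [Group A] {H K : Subgroup A} {φ : H ≃* K}

theorem exists_hasInvariantMean_separatesReduced
    (hφ : ∃ α : A ≃* A, ∀ h : H, α (h : A) = (φ h : A)) (hA : HasInvariantMean A) (n : ℕ) :
    ∃ (Q : Type u) (_ : Group Q) (π : HNNExtension A H K φ →* Q), HasInvariantMean Q ∧
      Function.Injective (π.comp of) ∧ SeparatesReduced π n := by
  induction n with
  | zero =>
    obtain ⟨α, hα⟩ := hφ
    let ψ : Multiplicative ℤ →* MulAut A := zpowersHom (MulAut A) α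
    let π : HNNExtension A H K φ →* A ⋊[ψ] Multiplicative ℤ :=
      lift SemidirectProduct.inl (SemidirectProduct.inr (Multiplicative.ofAdd 1)) (by
        intro a
        ext <;> simp [ψ, hα])
    refine ⟨A ⋊[ψ] Multiplicative ℤ, inferInstance, π,
      hA.semidirectProduct (hasInvariantMean_of_commGroup _) ψ, ?_, ?_⟩
    · intro a b hab
      exact SemidirectProduct.inl_injective (φ := ψ) (by simpa [π] using hab)
    · intro l _ hne hlen
      exact absurd (List.eq_nil_of_length_eq_zero (Nat.le_zero.1 hlen)) hne
  | succ n ih =>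
    obtain ⟨Q, _, π, hQ, hinj, hn⟩ := ih
    exact ⟨EdgeWreath π, inferInstance, crossingHom π,
      (hasInvariantMean_of_commGroup _).semidirectProduct hQ _,
      crossingHom_comp_of_injective π hinj, hn.crossingHom π hinj⟩

theorem exists_eq_of_mul_wordProd (g : HNNExtension A H K φ) :
    ∃ (a : A) (l : List (ℤˣ × A)), IsReducedList H K l ∧ g = of a * wordProd φ l := by
  obtain ⟨d⟩ := NormalWord.TransversalPair.nonempty A H K
  let w := NormalWord.equiv φ d g
  exact ⟨w.head, w.toList, w.chain, ((NormalWord.equiv φ d).symm_apply_apply g).symm⟩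

end Residual

theorem proposition11 {A : Type u} [Group A] (H K : Subgroup A) (φ : H ≃* K)
    (hφ : ∃ α : A ≃* A, ∀ h : H, α (h : A) = (φ h : A))
    (hA : IsAmenableGroup A) :
    IsResiduallyAmenable (HNNExtension A H K φ) := by
  intro g hg
  obtain ⟨a, l, hl, rfl⟩ := exists_eq_of_mul_wordProd g
  obtain ⟨Q, _, π, hQ, hinj, hsep⟩ := exists_hasInvariantMean_separatesReduced hφ
    ((isAmenableGroup_iff_hasInvariantMean A).1 hA) l.length
  -- Surjectivity is obtained by restricting to the range, a subgroup of an amenable group.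
  refine ⟨π.range, inferInstance, π.rangeRestrict,
    (isAmenableGroup_iff_hasInvariantMean _).2 (hQ.subgroup _), π.rangeRestrict_surjective,
    fun h => ?_⟩
  replace h : π (of a * wordProd φ l) = 1 := congrArg Subtype.val h
  obtain rfl | hne := eq_or_ne l []
  · have ha : a = 1 := hinj (by simpa using h)
    exact hg (by simp [ha])
  · refine hsep l hl hne le_rfl a⁻¹ ?_
    rw [map_mul] at h
    rw [map_inv, map_inv, eq_inv_of_mul_eq_one_right h]
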